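/- Let $P_1,P_2,N_1,N_2>0$, $a_{12}\ge N_1/N_2$ and $a_{21}\ge N_2/N_1$. For $Q_1,Q_2>0$ consider the two-user additive state-dependent Gaussian interference channel, whose outputs over a block of length $n$ are $$\boldsymbol Y_1=\boldsymbol X_1+\sqrt{a_{12}}\,\boldsymbol X_2+\boldsymbol S_1+\sqrt{a_{12}}\,\boldsymbol S_2+\boldsymbol Z_1,\qquad \boldsymbol Y_2=\sqrt{a_{21}}\,\boldsymbol X_1+\boldsymbol X_2+\sqrt{a_{21}}\,\boldsymbol S_1+\boldsymbol S_2+\boldsymbol Z_2,$$ where $\boldsymbol S_1,\boldsymbol S_2,\boldsymbol Z_1,\boldsymbol Z_2$ are independent and $\boldsymbol S_i$, $\boldsymbol Z_i$ have i.i.d. coordinates distributed as $\mathcal N(0,Q_i)$ and $\mathcal N(0,N_i)$. The messages $W_1,W_2$ are independent of each other and of the states and noises, and $W_i$ is uniform on a set of $\lceil 2^{nR_i}\rceil$ elements. Encoder $i$ produces $\boldsymbol X_i$ as a function of $W_i$ and of the whole sequence $\boldsymbol S_i$, subject to $\frac1n\sum_{j=1}^n\mathbb E|X_i[j]|^2\le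 P_i$; decoder $i$ produces an estimate $\hat W_i$ as a function of $\boldsymbol Y_i$ alone. A pair $(R_1,R_2)$ of nonnegative reals is achievable if there is a sequence of such codes, one for each length $n$, with $\Pr\{\hat W_1\ne W_1\text{ or }\hat W_2\ne W_2\}\to0$ as $n\to\infty$; the capacity region $\mathcal C(Q_1,Q_2)$ is the closure of the set of achievable pairs. In the limit $Q_1,Q_2\to\infty$ the capacity region is contained in the region of pairs $R_1,R_2\ge0$ with $$R_1+R_2\le B:=\min\left(\tfrac12\log_2\left(1+\tfrac{a_{12}P_2}{N_1}\right),\ \tfrac12\log_2\left(1+\tfrac{a_{21}P_1}{N_2}\right)\right).$$ That is: every limit point of pairs $(R_1,R_2)\in\mathcal C(Q_1,Q_2)$ as $Q_1,Q_2\to\infty$ satisfies $R_1,R_2\ge 0$ and $R_1+R_2\le B$; and, uniformly, for every $\varepsilon>0$ there is $Q_0$ such that for all $Q_1,Q_2\ge Q_0$ every $(R_1,R_2)\in\mathcal C(Q_1,Q_2)$ satisfies $R_1,R_2\ge0$ and $R_1+R_2\le B+\varepsilon$. -/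

import Mathlib

open MeasureTheory ProbabilityTheory Filter Topology

noncomputable section

/-- Parameters of the two-user additive state-dependent Gaussian interference channel:
interference gains `a12`, `a21`, input powers `P1`, `P2`, noise variances `N1`, `N2`
and state variances `Q1`, `Q2`. -/
structure ASDGIC where
  a12 : ℝ
  a21 : ℝ
  P1 : ℝ
  P2 : ℝ
  N1 : ℝ
  N2 : ℝ
  Q1 : ℝ
  Q2 : ℝ

namespace ASDGIC

/-- Law of a vector of `n` i.i.d. centred Gaussian variables of variance `v`. -/
def iidGaussian (n : ℕ) (v : ℝ) : Measure (Fin n → ℝ) :=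
  Measure.pi fun _ => gaussianReal 0 v.toNNReal

/-- Joint law of `((S₁, S₂), (Z₁, Z₂))`: independent states and independent noises. -/
def law (c : ASDGIC) (n : ℕ) :
    Measure (((Fin n → ℝ) × (Fin n → ℝ)) × ((Fin n → ℝ) × (Fin n → ℝ))) :=
  ((iidGaussian n c.Q1).prod (iidGaussian n c.Q2)).prod
    ((iidGaussian n c.N1).prod (iidGaussian n c.N2))

/-- Output at receiver 1: `Y₁ = X₁ + √a₁₂ X₂ + S₁ + √a₁₂ S₂ + Z₁`. -/
def output1 (c : ASDGIC) {n : ℕ} (x1 x2 s1 s2 z1 : Fin n → ℝ) : Fin n → ℝ :=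
  x1 + √c.a12 • x2 + s1 + √c.a12 • s2 + z1

/-- Output at receiver 2: `Y₂ = √a₂₁ X₁ + X₂ + √a₂₁ S₁ + S₂ + Z₂`. -/
def output2 (c : ASDGIC) {n : ℕ} (x1 x2 s1 s2 z2 : Fin n → ℝ) : Fin n → ℝ :=
  √c.a21 • x1 + x2 + √c.a21 • s1 + s2 + z2

/-- A block code of length `n` with `M1` and `M2` messages. Encoder `i` sees its message and
the whole state sequence `Sᵢ`; decoder `i` sees only the output sequence `Yᵢ`. -/
structure Code (n M1 M2 : ℕ) where
  enc1 : Fin M1 → (Fin n → ℝ) → (Fin n → ℝ)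
  enc2 : Fin M2 → (Fin n → ℝ) → (Fin n → ℝ)
  dec1 : (Fin n → ℝ) → Fin M1
  dec2 : (Fin n → ℝ) → Fin M2
  measurable_enc1 : ∀ w, Measurable (enc1 w)
  measurable_enc2 : ∀ w, Measurable (enc2 w)
  measurable_dec1 : Measurable dec1
  measurable_dec2 : Measurable dec2

/-- `(1/n) ∑ⱼ E |X[j]|² ≤ P` for `X = enc W S`, where `W` is uniform on the `M` messages and
`S` is an independent i.i.d. Gaussian state of variance `Q`. -/
def PowerLimited {n M : ℕ} (enc : Fin M → (Fin n → ℝ) → (Fin n → ℝ)) (Q P : ℝ) : Prop :=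
  (∀ w j, Integrable (fun s => (enc w s j) ^ 2) (iidGaussian n Q)) ∧
    (1 / (n : ℝ)) * ∑ j, (1 / (M : ℝ)) * ∑ w, ∫ s, (enc w s j) ^ 2 ∂(iidGaussian n Q) ≤ P

/-- The event that at least one receiver decodes its message wrongly when `(w1, w2)` is sent. -/
def errorEvent (c : ASDGIC) {n M1 M2 : ℕ} (C : Code n M1 M2) (w1 : Fin M1) (w2 : Fin M2) :
    Set (((Fin n → ℝ) × (Fin n → ℝ)) × ((Fin n → ℝ) × (Fin n → ℝ))) :=
  {ω | C.dec1 (c.output1 (C.enc1 w1 ω.1.1) (C.enc2 w2 ω.1.2) ω.1.1 ω.1.2 ω.2.1) ≠ w1 ∨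
       C.dec2 (c.output2 (C.enc1 w1 ω.1.1) (C.enc2 w2 ω.1.2) ω.1.1 ω.1.2 ω.2.2) ≠ w2}

/-- Average error probability, the message pair being uniform. -/
def errorProb (c : ASDGIC) {n M1 M2 : ℕ} (C : Code n M1 M2) : ℝ :=
  (1 / ((M1 : ℝ) * M2)) * ∑ w1, ∑ w2, (c.law n).real (c.errorEvent C w1 w2)

/-- Number of messages `⌈2 ^ (n R)⌉` of a code of length `n` and rate `R`. -/
def numMessages (n : ℕ) (R : ℝ) : ℕ := ⌈(2 : ℝ) ^ ((n : ℝ) * R)⌉₊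

/-- Achievability of a pair of (nonnegative) rates. -/
def Achievable (c : ASDGIC) (R : ℝ × ℝ) : Prop :=
  0 ≤ R.1 ∧ 0 ≤ R.2 ∧
    ∃ C : ∀ n : ℕ, Code n (numMessages n R.1) (numMessages n R.2),
      (∀ n, PowerLimited (C n).enc1 c.Q1 c.P1 ∧ PowerLimited (C n).enc2 c.Q2 c.P2) ∧
      Tendsto (fun n => c.errorProb (C n)) atTop (𝓝 0)

/-- The capacity region: the closure of the set of achievable rate pairs. -/
def capacityRegion (c : ASDGIC) : Set (ℝ × ℝ) :=
  closure {R | c.Achievable R}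

/-- The limit (Kuratowski upper limit) of the capacity region as `Q₁, Q₂ → ∞`: all rate pairs
that are limit points of points of the capacity regions along state variances tending to
infinity. -/
def limitCapacityRegion (a12 a21 P1 P2 N1 N2 : ℝ) : Set (ℝ × ℝ) :=
  {R | ∀ U ∈ 𝓝 R, ∃ᶠ Q : ℝ × ℝ in atTop ×ˢ atTop,
    (capacityRegion ⟨a12, a21, P1, P2, N1, N2, Q.1, Q.2⟩ ∩ U).Nonempty}

/-- The bound `min (½ log₂ (1 + a₁₂P₂/N₁)) (½ log₂ (1 + a₂₁P₁/N₂))` on the sum rate. -/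
def sumRateBound (a12 a21 P1 P2 N1 N2 : ℝ) : ℝ :=
  min (1 / 2 * Real.logb 2 (1 + a12 * P2 / N1)) (1 / 2 * Real.logb 2 (1 + a21 * P1 / N2))

/-- Pairs of nonnegative rates whose sum is at most `B`. -/
def sumRateRegion (B : ℝ) : Set (ℝ × ℝ) :=
  {R | 0 ≤ R.1 ∧ 0 ≤ R.2 ∧ R.1 + R.2 ≤ B}

end ASDGIC

end

/-!
Only the marginals of `(Z₁, Z₂)` matter, and `N₁ / a₁₂ ≤ N₂`, so `Z₂` may be taken to be
`Z₁ / √a₁₂ + V` with `V` independent of `Z₁`. If a genie gives `S₁` and `V` to receiver 1, then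
after decoding `W₁` it can reconstruct `Y₂` and decode `W₂` as well. What it observes is `(S₁, V)`
and the reduced output `Y = X₁ + √a₁₂ (X₂ + S₂) + Z₁`.

The map `(S₂, Z₁) ↦ (Y, X₂ + Z₁ / √a₁₂)` is a composition of shears whatever the encoders are. So
for each message pair there is a law under which `Y` and `X₂ + Z₁ / √a₁₂` are independent Gaussian
blocks of variances `T` and `σ`, independent of `(S₁, V)`; under it the observation does not
depend on the messages, and the decoding regions have total mass at most one. By the power
constraints the expected logarithm of the density of the true law with respect to it is, averaged
over the messages, at most `(n / 2) log (T σ / (Q₂ N₁))`, where `σ = P₂ + N₁ / a₁₂` and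
`T = a₁₂ Q₂ (1 + o(1))` as `Q₂ → ∞`. This gives a sum rate of at most
`½ log₂ (1 + a₁₂ P₂ / N₁) + o(1)`; exchanging the users gives the other bound.
-/

noncomputable section

namespace ASDGIC

section ChangeOfMeasure

variable {Ω E : Type*} [MeasurableSpace Ω] [MeasurableSpace E]

/-- The inequality `1 + x ≤ exp x`, with `x` the excess of `log M` on `B` over `ℓ`, integrated. -/
lemma log_mul_measureReal_le {μ : Measure Ω} [IsProbabilityMeasure μ] {ℓ : Ω → ℝ}
    (hℓ : Integrable ℓ μ) (hexp : Integrable (fun ω => Real.exp (-ℓ ω)) μ) {B : Set Ω}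
    (hB : MeasurableSet B) {M : ℝ} (hM : 0 < M) :
    Real.log M * μ.real B + 1 ≤
      ∫ ω, ℓ ω ∂μ + ∫ ω, Real.exp (-ℓ ω) ∂μ + M * ∫ ω in B, Real.exp (-ℓ ω) ∂μ := by
  have hpoint (ω : Ω) : B.indicator (fun _ => Real.log M) ω + 1 ≤
      ℓ ω + Real.exp (-ℓ ω) + M * B.indicator (fun ω => Real.exp (-ℓ ω)) ω := by
    have hpos := Real.exp_nonneg (-ℓ ω)
    by_cases hω : ω ∈ B
    · have h := Real.add_one_le_exp (Real.log M + -ℓ ω)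
      rw [Real.exp_add, Real.exp_log hM] at h
      simp only [Set.indicator_of_mem hω]
      linarith
    · have h := Real.add_one_le_exp (-ℓ ω)
      simp only [Set.indicator_of_notMem hω]
      linarith
  have hlog : Integrable (B.indicator fun _ => Real.log M) μ := (integrable_const _).indicator hB
  have hinteg := integral_mono (hlog.add (integrable_const 1))
    ((hℓ.add hexp).add ((hexp.indicator hB).const_mul M)) hpoint
  rw [integral_add' hlog (integrable_const _), integral_add' (hℓ.add hexp)
    ((hexp.indicator hB).const_mul M), integral_add' hℓ hexp, integral_indicator_const _ hB,
    integral_const_mul, integral_indicator hB] at hinteg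
  simpa [mul_comm] using hinteg

lemma integral_preimage_of_measurePreserving_withDensity {μ : Measure Ω} {ν : Measure E}
    {d : Ω → ℝ} (hd : Measurable d) (hd0 : 0 ≤ d) {f : Ω → E}
    (hf : MeasurePreserving f (μ.withDensity fun ω => ENNReal.ofReal (d ω)) ν) {A : Set E}
    (hA : MeasurableSet A) : ∫ ω in f ⁻¹' A, d ω ∂μ = ν.real A := by
  rw [integral_eq_lintegral_of_nonneg_ae (ae_of_all _ hd0) hd.aestronglyMeasurable,
    ← withDensity_apply _ (hf.measurable hA), hf.measure_preimage hA.nullMeasurableSet,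
    measureReal_def]

lemma integrable_of_measurePreserving_withDensity {μ : Measure Ω} {ν : Measure E}
    [IsFiniteMeasure ν] {d : Ω → ℝ} (hd : Measurable d) (hd0 : 0 ≤ d) {f : Ω → E}
    (hf : MeasurePreserving f (μ.withDensity fun ω => ENNReal.ofReal (d ω)) ν) :
    Integrable d μ := by
  refine (lintegral_ofReal_ne_top_iff_integrable hd.aestronglyMeasurable (ae_of_all _ hd0)).1 ?_
  rw [← setLIntegral_univ, ← withDensity_apply _ MeasurableSet.univ,
    ← Set.preimage_univ (f := f), hf.measure_preimage MeasurableSet.univ.nullMeasurableSet]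
  exact measure_ne_top _ _

/-- Under the auxiliary laws `exp (-ℓ w) • P w` the observation `f w` has the same law `ν` for all
`w`, so that the disjoint decoding regions `A w` have total mass at most one. -/
lemma log_card_mul_sum_measureReal_le {ι : Type*} [Fintype ι] {P : ι → Measure Ω}
    [∀ w, IsProbabilityMeasure (P w)] {ν : Measure E} [IsProbabilityMeasure ν] {ℓ : ι → Ω → ℝ}
    (hℓm : ∀ w, Measurable (ℓ w)) (hℓ : ∀ w, Integrable (ℓ w) (P w)) {f : ι → Ω → E}
    (hf : ∀ w, MeasurePreserving (f w)
      ((P w).withDensity fun ω => ENNReal.ofReal (Real.exp (-ℓ w ω))) ν)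
    {A : ι → Set E} (hA : ∀ w, MeasurableSet (A w))
    (hdisj : Pairwise (Function.onFun Disjoint A)) :
    Real.log (Fintype.card ι) * ∑ w, (P w).real (f w ⁻¹' A w) ≤
      ∑ w, ∫ ω, ℓ w ω ∂P w + Fintype.card ι := by
  have hterm (w : ι) : Real.log (Fintype.card ι) * (P w).real (f w ⁻¹' A w) ≤
      ∫ ω, ℓ w ω ∂P w + Fintype.card ι * ν.real (A w) := by
    have hcard : (0 : ℝ) < Fintype.card ι := by exact_mod_cast Fintype.card_pos_iff.2 ⟨w⟩
    have hd : Measurable fun ω => Real.exp (-ℓ w ω) := (hℓm w).neg.exp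
    have hd0 : 0 ≤ fun ω => Real.exp (-ℓ w ω) := fun ω => Real.exp_nonneg _
    have hmass := integral_preimage_of_measurePreserving_withDensity hd hd0 (hf w) .univ
    rw [Set.preimage_univ, setIntegral_univ, probReal_univ] at hmass
    have h := log_mul_measureReal_le (hℓ w)
      (integrable_of_measurePreserving_withDensity hd hd0 (hf w)) ((hf w).measurable (hA w)) hcard
    rw [hmass, integral_preimage_of_measurePreserving_withDensity hd hd0 (hf w) (hA w)] at h
    linarith
  have hpack : ∑ w, ν.real (A w) ≤ 1 := by
    rw [← measureReal_biUnion_finset (hdisj.set_pairwise _) fun w _ => hA w]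
    exact measureReal_le_one
  calc _ = ∑ w, Real.log (Fintype.card ι) * (P w).real (f w ⁻¹' A w) := Finset.mul_sum ..
    _ ≤ ∑ w, (∫ ω, ℓ w ω ∂P w + Fintype.card ι * ν.real (A w)) :=
        Finset.sum_le_sum fun w _ => hterm w
    _ = ∑ w, ∫ ω, ℓ w ω ∂P w + Fintype.card ι * ∑ w, ν.real (A w) := by
        rw [Finset.sum_add_distrib, Finset.mul_sum]
    _ ≤ _ := by grw [hpack, mul_one]

lemma measurePreserving_withDensity_comp {μ : Measure Ω} {ν : Measure E} {f : Ω → E}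
    (hf : MeasurePreserving f μ ν) {ρ : E → ENNReal} (hρ : Measurable ρ) :
    MeasurePreserving f (μ.withDensity fun ω => ρ (f ω)) (ν.withDensity ρ) := by
  refine ⟨hf.measurable, Measure.ext fun s hs => ?_⟩
  rw [Measure.map_apply hf.measurable hs, withDensity_apply _ (hf.measurable hs),
    withDensity_apply _ hs, hf.setLIntegral_comp_preimage hs hρ]

lemma measurePreserving_prodProdProdComm {α β γ δ : Type*} [MeasurableSpace α]
    [MeasurableSpace β] [MeasurableSpace γ] [MeasurableSpace δ] (μa : Measure α) (μb : Measure β)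
    (μc : Measure γ) (μd : Measure δ) [SFinite μa] [SFinite μb] [SFinite μc] [SFinite μd] :
    MeasurePreserving (fun p : (α × β) × γ × δ => ((p.1.1, p.2.1), p.1.2, p.2.2))
      ((μa.prod μb).prod (μc.prod μd)) ((μa.prod μc).prod (μb.prod μd)) := by
  have hinner : MeasurePreserving (fun p : β × γ × δ => (p.2.1, p.1, p.2.2))
      (μb.prod (μc.prod μd)) (μc.prod (μb.prod μd)) :=
    (measurePreserving_prodAssoc μc μb μd).comp
      ((Measure.measurePreserving_swap.prod (MeasurePreserving.id μd)).comp
        (measurePreserving_prodAssoc μb μc μd).symm)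
  exact (measurePreserving_prodAssoc μa μc (μb.prod μd)).symm.comp
    (((MeasurePreserving.id μa).prod hinner).comp
      (measurePreserving_prodAssoc μa μb (μc.prod μd)))

lemma measurePreserving_shear {Θ G : Type*} [MeasurableSpace Θ] [AddCommGroup G]
    [MeasurableSpace G] [MeasurableAdd₂ G] [MeasurableNeg G] {κ : Measure Θ} [SFinite κ]
    {μ : Measure G} [SFinite μ] [μ.IsAddLeftInvariant] [μ.IsNegInvariant] {m g : Θ → G → G}
    (hm : Measurable (Function.uncurry m)) (hg : Measurable (Function.uncurry g)) :
    MeasurePreserving (fun p : Θ × G × G =>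
        (p.1, m p.1 p.2.1 + p.2.2, g p.1 (m p.1 p.2.1 + p.2.2) - p.2.1))
      (κ.prod (μ.prod μ)) (κ.prod (μ.prod μ)) := by
  have hfibre (θ : Θ) : MeasurePreserving
      (fun p : G × G => (m θ p.1 + p.2, g θ (m θ p.1 + p.2) - p.1)) (μ.prod μ) (μ.prod μ) := by
    have hmθ : Measurable (m θ) := hm.of_uncurry_left
    have hgθ : Measurable (g θ) := hg.of_uncurry_left
    have hadd : MeasurePreserving (fun p : G × G => (p.1, m θ p.1 + p.2))
        (μ.prod μ) (μ.prod μ) :=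
      (MeasurePreserving.id μ).skew_product (g := fun s z => m θ s + z) (by fun_prop)
        (ae_of_all _ fun s => map_add_left_eq_self μ (m θ s))
    have hsub : MeasurePreserving (fun p : G × G => (p.1, g θ p.1 - p.2))
        (μ.prod μ) (μ.prod μ) :=
      (MeasurePreserving.id μ).skew_product (g := fun y s => g θ y - s) (by fun_prop)
        (ae_of_all _ fun y => (Measure.measurePreserving_sub_left μ (g θ y)).map_eq)
    exact hsub.comp (Measure.measurePreserving_swap.comp hadd)
  refine (MeasurePreserving.id κ).skew_product
    (g := fun θ (p : G × G) => (m θ p.1 + p.2, g θ (m θ p.1 + p.2) - p.1)) ?_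
    (ae_of_all _ fun θ => (hfibre θ).map_eq)
  have hm' : Measurable fun q : Θ × G × G => m q.1 q.2.1 :=
    hm.comp (measurable_fst.prodMk measurable_snd.fst)
  have hy : Measurable fun q : Θ × G × G => m q.1 q.2.1 + q.2.2 := hm'.add measurable_snd.snd
  exact hy.prodMk ((hg.comp (measurable_fst.prodMk hy)).sub measurable_snd.fst)

end ChangeOfMeasure

section Gaussian

/-- Real sequences of length `n`, the inputs, states, noises and outputs of one block. -/
abbrev Block (n : ℕ) := Fin n → ℝ

variable {n : ℕ}

instance instIsProbabilityMeasureIidGaussian (n : ℕ) (v : ℝ) :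
    IsProbabilityMeasure (iidGaussian n v) := by
  unfold iidGaussian; infer_instance

/-- Logarithm of the density of `n` i.i.d. centred Gaussian variables of variance `v`. -/
def logDensity (v : ℝ) (x : Block n) : ℝ :=
  -(n / 2 * Real.log (2 * Real.pi * v)) - x ⬝ᵥ x / (2 * v)

@[fun_prop]
lemma measurable_logDensity (v : ℝ) : Measurable (logDensity (n := n) v) := by
  unfold logDensity dotProduct; fun_prop

lemma prod_gaussianPDFReal_eq_exp_logDensity {v : ℝ} (hv : 0 < v) (x : Block n) :
    ∏ i, gaussianPDFReal 0 v.toNNReal (x i) = Real.exp (logDensity v x) := by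
  have h2 : (0 : ℝ) < 2 * Real.pi * v := by positivity
  have h (t : ℝ) : gaussianPDFReal 0 v.toNNReal t =
      Real.exp (-(1 / 2 * Real.log (2 * Real.pi * v)) - t * t / (2 * v)) := by
    rw [gaussianPDFReal, Real.coe_toNNReal _ hv.le, sub_eq_add_neg (-(1 / 2 * _)), Real.exp_add,
      Real.exp_neg, sub_zero, neg_div, Real.sqrt_eq_rpow, Real.rpow_def_of_pos h2, sq,
      mul_comm (Real.log _)]
  simp_rw [h, ← Real.exp_sum, Finset.sum_sub_distrib, logDensity, dotProduct, Finset.sum_div]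
  simp only [Finset.sum_const, Finset.card_univ, Fintype.card_fin, nsmul_eq_mul]
  congr 2
  ring

lemma iidGaussian_eq_withDensity (n : ℕ) {v : ℝ} (hv : 0 < v) :
    iidGaussian n v =
      volume.withDensity fun x => ENNReal.ofReal (Real.exp (logDensity v x)) := by
  have hv' : v.toNNReal ≠ 0 := by simpa using hv
  refine Measure.pi_eq fun s hs => ?_
  have hpdf (i : Fin n) :
      Integrable (gaussianPDFReal 0 v.toNNReal) (volume.restrict (s i)) :=
    (integrable_gaussianPDFReal _ _).restrict
  have hnonneg (x : Block n) : 0 ≤ ∏ i, gaussianPDFReal 0 v.toNNReal (x i) :=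
    Finset.prod_nonneg fun i _ => gaussianPDFReal_nonneg _ _ _
  simp_rw [withDensity_apply _ (MeasurableSet.univ_pi hs),
    ← prod_gaussianPDFReal_eq_exp_logDensity hv, volume_pi, Measure.restrict_pi_pi]
  rw [← ofReal_integral_eq_lintegral_ofReal (Integrable.fintype_prod hpdf) (ae_of_all _ hnonneg),
    integral_fintype_prod_eq_prod, ENNReal.ofReal_prod_of_nonneg fun i _ =>
      integral_nonneg fun _ => gaussianPDFReal_nonneg _ _ _]
  simp only [gaussianReal_apply_eq_integral _ hv']

variable {Θ : Type*} [MeasurableSpace Θ]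

lemma prod_iidGaussian_prod_eq_withDensity (κ : Measure Θ) {Q N : ℝ} (hQ : 0 < Q)
    (hN : 0 < N) :
    κ.prod ((iidGaussian n Q).prod (iidGaussian n N)) =
      (κ.prod (volume.prod volume)).withDensity fun p =>
        ENNReal.ofReal (Real.exp (logDensity Q p.2.1 + logDensity N p.2.2)) := by
  rw [iidGaussian_eq_withDensity n hQ, iidGaussian_eq_withDensity n hN,
    prod_withDensity (by fun_prop) (by fun_prop), prod_withDensity_right (by fun_prop)]
  simp only [Real.exp_add, ENNReal.ofReal_mul (Real.exp_nonneg _)]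

/-- The weight is the likelihood ratio of the law under which `m θ s + z` has variance `T` and
`g θ (m θ s + z) - s` has variance `σ`, independently of each other and of `θ`, to the law under
which `s` and `z` have variances `Q` and `N`. -/
lemma measurePreserving_shear_iidGaussian (κ : Measure Θ) [SFinite κ] {Q N T σ : ℝ} (hQ : 0 < Q)
    (hN : 0 < N) (hT : 0 < T) (hσ : 0 < σ) {m g : Θ → Block n → Block n}
    (hm : Measurable (Function.uncurry m)) (hg : Measurable (Function.uncurry g)) :
    MeasurePreserving (fun p : Θ × Block n × Block n =>
        (p.1, m p.1 p.2.1 + p.2.2, g p.1 (m p.1 p.2.1 + p.2.2) - p.2.1))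
      ((κ.prod ((iidGaussian n Q).prod (iidGaussian n N))).withDensity fun p =>
        ENNReal.ofReal (Real.exp (-(logDensity Q p.2.1 + logDensity N p.2.2 -
          logDensity T (m p.1 p.2.1 + p.2.2) -
          logDensity σ (g p.1 (m p.1 p.2.1 + p.2.2) - p.2.1)))))
      (κ.prod ((iidGaussian n T).prod (iidGaussian n σ))) := by
  have hshear := measurePreserving_shear (κ := κ) (μ := (volume : Measure (Block n))) hm hg
  rw [prod_iidGaussian_prod_eq_withDensity κ hQ hN, prod_iidGaussian_prod_eq_withDensity κ hT hσ,
    ← withDensity_mul _ (by fun_prop) (by fun_prop)]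
  convert measurePreserving_withDensity_comp hshear (ρ := fun p => ENNReal.ofReal
    (Real.exp (logDensity T p.2.1 + logDensity σ p.2.2))) (by fun_prop) using 2
  ext p
  rw [Pi.mul_apply, ← ENNReal.ofReal_mul (Real.exp_nonneg _), ← Real.exp_add]
  congr 2
  ring

lemma map_const_mul_gaussianReal_toNNReal (b v : ℝ) :
    (gaussianReal 0 v.toNNReal).map (b * ·) = gaussianReal 0 (b ^ 2 * v).toNNReal := by
  rw [gaussianReal_map_const_mul, mul_zero, Real.toNNReal_mul (sq_nonneg b),
    Real.toNNReal_of_nonneg (sq_nonneg b)]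

lemma measurePreserving_smul_add_iidGaussian (n : ℕ) (b : ℝ) {v w : ℝ} (hv : 0 ≤ v)
    (hw : 0 ≤ w) :
    MeasurePreserving (fun p : Block n × Block n => b • p.1 + p.2)
      ((iidGaussian n v).prod (iidGaussian n w)) (iidGaussian n (b ^ 2 * v + w)) := by
  have hcoord : MeasurePreserving (fun p : ℝ × ℝ => b * p.1 + p.2)
      ((gaussianReal 0 v.toNNReal).prod (gaussianReal 0 w.toNNReal))
      (gaussianReal 0 (b ^ 2 * v + w).toNNReal) := by
    have hadd : MeasurePreserving (fun p : ℝ × ℝ => p.1 + p.2)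
        ((gaussianReal 0 (b ^ 2 * v).toNNReal).prod (gaussianReal 0 w.toNNReal))
        (gaussianReal 0 (b ^ 2 * v + w).toNNReal) := by
      refine ⟨by fun_prop, ?_⟩
      rw [← Measure.conv, gaussianReal_conv_gaussianReal, add_zero,
        ← Real.toNNReal_add (by positivity) hw]
    have hmul : MeasurePreserving (b * ·) (gaussianReal 0 v.toNNReal)
        (gaussianReal 0 (b ^ 2 * v).toNNReal) :=
      ⟨by fun_prop, map_const_mul_gaussianReal_toNNReal b v⟩
    exact hadd.comp (hmul.prod (MeasurePreserving.id _))
  exact (measurePreserving_pi _ _ fun _ => hcoord).comp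
    (measurePreserving_arrowProdEquivProdArrow ℝ ℝ (Fin n) _ _).symm

end Gaussian

section MeanEnergy

variable {Ω Ω' : Type*} [MeasurableSpace Ω] [MeasurableSpace Ω'] {μ : Measure Ω} {n : ℕ}

/-- The energy `E |X|²` of the random block `f`, the Euclidean square being written `x ⬝ᵥ x`
because `Block n` carries the sup norm. -/
def meanEnergy (μ : Measure Ω) (f : Ω → Block n) : ℝ := ∫ ω, f ω ⬝ᵥ f ω ∂μ

lemma integrable_dotProduct {f g : Ω → Block n} (hf : MemLp f 2 μ) (hg : MemLp g 2 μ) :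
    Integrable (fun ω => f ω ⬝ᵥ g ω) μ :=
  integrable_finsetSum _ fun i _ => (memLp_pi_iff.1 hf i).integrable_mul (memLp_pi_iff.1 hg i)

lemma meanEnergy_comp {ν : Measure Ω'} {g : Ω → Ω'} (hg : MeasurePreserving g μ ν)
    {f : Ω' → Block n} (hf : Measurable f) :
    meanEnergy μ (fun ω => f (g ω)) = meanEnergy ν f := by
  have hsq : Measurable fun ω => f ω ⬝ᵥ f ω := by unfold dotProduct; fun_prop
  rw [meanEnergy, meanEnergy, ← hg.map_eq,
    integral_map hg.measurable.aemeasurable hsq.aestronglyMeasurable]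

lemma meanEnergy_smul (b : ℝ) (f : Ω → Block n) :
    meanEnergy μ (b • f) = b ^ 2 * meanEnergy μ f := by
  simp only [meanEnergy, Pi.smul_apply, smul_dotProduct, dotProduct_smul, smul_eq_mul,
    integral_const_mul]
  ring

lemma add_dotProduct_self_le (x y : Block n) {δ : ℝ} (hδ : 0 < δ) :
    (x + y) ⬝ᵥ (x + y) ≤ (1 + δ) * x ⬝ᵥ x + (1 + 1 / δ) * y ⬝ᵥ y := by
  simp only [dotProduct, Pi.add_apply, Finset.mul_sum, ← Finset.sum_add_distrib]
  refine Finset.sum_le_sum fun i _ => sub_nonneg.1 ?_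
  have hsq : (1 + δ) * (x i * x i) + (1 + 1 / δ) * (y i * y i) - (x i + y i) * (x i + y i) =
      (δ * x i - y i) ^ 2 / δ := by
    field_simp
    ring
  rw [hsq]
  positivity

lemma meanEnergy_add_le {f g : Ω → Block n} (hf : MemLp f 2 μ) (hg : MemLp g 2 μ) {δ : ℝ}
    (hδ : 0 < δ) :
    meanEnergy μ (f + g) ≤ (1 + δ) * meanEnergy μ f + (1 + 1 / δ) * meanEnergy μ g := by
  have hfg := hf.add hg
  rw [meanEnergy, meanEnergy, meanEnergy, ← integral_const_mul, ← integral_const_mul,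
    ← integral_add ((integrable_dotProduct hf hf).const_mul _)
      ((integrable_dotProduct hg hg).const_mul _)]
  exact integral_mono (integrable_dotProduct hfg hfg)
    (((integrable_dotProduct hf hf).const_mul _).add ((integrable_dotProduct hg hg).const_mul _))
    fun ω => add_dotProduct_self_le _ _ hδ

lemma memLp_eval_iidGaussian (v : ℝ) (i : Fin n) :
    MemLp (fun x : Block n => x i) 2 (iidGaussian n v) :=
  (memLp_id_gaussianReal' 2 (by simp)).comp_measurePreserving (measurePreserving_eval _ i)

lemma memLp_id_iidGaussian (v : ℝ) : MemLp (fun x : Block n => x) 2 (iidGaussian n v) :=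
  memLp_pi_iff.2 (memLp_eval_iidGaussian v)

lemma integral_eval_iidGaussian (v : ℝ) (i : Fin n) : ∫ x, x i ∂iidGaussian n v = 0 :=
  (integral_comp_eval (μ := fun _ : Fin n => gaussianReal 0 v.toNNReal) (f := fun t : ℝ => t)
    (by fun_prop)).trans integral_id_gaussianReal

lemma integral_mul_self_eval_iidGaussian {v : ℝ} (hv : 0 ≤ v) (i : Fin n) :
    ∫ x, x i * x i ∂iidGaussian n v = v := by
  have hvar := variance_fun_id_gaussianReal (μ := 0) (v := v.toNNReal)
  rw [variance_of_integral_eq_zero (by fun_prop) integral_id_gaussianReal,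
    Real.coe_toNNReal _ hv] at hvar
  simp_rw [← sq]
  exact (integral_comp_eval (μ := fun _ : Fin n => gaussianReal 0 v.toNNReal)
    (f := fun t : ℝ => t ^ 2) (by fun_prop)).trans hvar

lemma meanEnergy_id_iidGaussian {v : ℝ} (hv : 0 ≤ v) :
    meanEnergy (iidGaussian n v) (fun x => x) = n * v := by
  have hinteg (i : Fin n) : Integrable (fun x : Block n => x i * x i) (iidGaussian n v) :=
    (memLp_eval_iidGaussian v i).integrable_mul (memLp_eval_iidGaussian v i)
  simp_rw [meanEnergy, dotProduct, integral_finsetSum _ fun i _ => hinteg i,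
    integral_mul_self_eval_iidGaussian hv]
  simp

lemma integral_dotProduct_prod_iidGaussian [IsProbabilityMeasure μ] {f : Ω → Block n}
    (hf : MemLp f 2 μ) (v : ℝ) :
    ∫ p : Ω × Block n, f p.1 ⬝ᵥ p.2 ∂μ.prod (iidGaussian n v) = 0 := by
  have hinteg (i : Fin n) :
      Integrable (fun p : Ω × Block n => f p.1 i * p.2 i) (μ.prod (iidGaussian n v)) :=
    ((memLp_pi_iff.1 hf i).comp_fst _).integrable_mul ((memLp_eval_iidGaussian v i).comp_snd _)
  simp only [dotProduct]
  rw [integral_finsetSum _ fun i _ => hinteg i]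
  refine Finset.sum_eq_zero fun i _ => ?_
  rw [integral_prod_mul (fun ω => f ω i) (fun x : Block n => x i), integral_eval_iidGaussian,
    mul_zero]

lemma meanEnergy_add_smul_iidGaussian [IsProbabilityMeasure μ] {f : Ω → Block n}
    (hf : MemLp f 2 μ) (b : ℝ) {v : ℝ} (hv : 0 ≤ v) :
    meanEnergy (μ.prod (iidGaussian n v)) (fun p => f p.1 + b • p.2) =
      meanEnergy μ f + b ^ 2 * (n * v) := by
  have hf' := hf.comp_fst (iidGaussian n v)
  have hz := (memLp_id_iidGaussian (n := n) v).comp_snd μ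
  have hexpand (p : Ω × Block n) : (f p.1 + b • p.2) ⬝ᵥ (f p.1 + b • p.2) =
      f p.1 ⬝ᵥ f p.1 + 2 * b * f p.1 ⬝ᵥ p.2 + b ^ 2 * p.2 ⬝ᵥ p.2 := by
    simp only [add_dotProduct, dotProduct_add, smul_dotProduct, dotProduct_smul, smul_eq_mul,
      dotProduct_comm p.2 (f p.1)]
    ring
  have hff := integrable_dotProduct hf' hf'
  have hfz := (integrable_dotProduct hf' hz).const_mul (2 * b)
  have hzz := (integrable_dotProduct hz hz).const_mul (b ^ 2)
  simp_rw [meanEnergy, hexpand]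
  rw [integral_add (hff.fun_add hfz) hzz, integral_add hff hfz, integral_const_mul,
    integral_const_mul, integral_dotProduct_prod_iidGaussian hf, mul_zero, add_zero,
    integral_fun_fst (fun ω => f ω ⬝ᵥ f ω), integral_fun_snd (fun x : Block n => x ⬝ᵥ x),
    probReal_univ, one_smul, probReal_univ, one_smul, ← meanEnergy_id_iidGaussian hv, meanEnergy]

lemma integrable_logDensity [IsFiniteMeasure μ] (v : ℝ) {f : Ω → Block n} (hf : MemLp f 2 μ) :
    Integrable (fun ω => logDensity v (f ω)) μ :=
  (integrable_const _).sub ((integrable_dotProduct hf hf).div_const _)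

lemma integral_logDensity [IsProbabilityMeasure μ] (v : ℝ) {f : Ω → Block n} (hf : MemLp f 2 μ) :
    ∫ ω, logDensity v (f ω) ∂μ =
      -(n / 2 * Real.log (2 * Real.pi * v)) - meanEnergy μ f / (2 * v) := by
  simp only [logDensity]
  rw [integral_sub (integrable_const _) ((integrable_dotProduct hf hf).div_const _),
    integral_const, probReal_univ, one_smul, integral_div, meanEnergy]

end MeanEnergy

section GenieAided

variable {Θ : Type*} {n : ℕ} {α Q N T σ : ℝ} {x1 : Θ → Block n} {x2 : Block n → Block n}

/-- What remains of `Y₁` once a known `S₁` is subtracted, with `α = √a₁₂`. -/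
def reducedOutput (α : ℝ) (x1 : Θ → Block n) (x2 : Block n → Block n)
    (p : Θ × Block n × Block n) : Block n :=
  x1 p.1 + α • (x2 p.2.1 + p.2.1) + p.2.2

/-- The error `X₂ + Z₁ / α` made in estimating the state `S₂` from `Θ` and the reduced output. -/
def residual (α : ℝ) (x2 : Block n → Block n) (p : Θ × Block n × Block n) : Block n :=
  x2 p.2.1 + α⁻¹ • p.2.2

lemma inv_smul_reducedOutput_sub (hα : α ≠ 0) (p : Θ × Block n × Block n) :
    α⁻¹ • (reducedOutput α x1 x2 p - x1 p.1) - p.2.1 = residual α x2 p := by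
  rw [reducedOutput, residual, add_assoc, add_sub_cancel_left, smul_add, inv_smul_smul₀ hα]
  abel

lemma reducedOutput_eq_smul_add (hα : α ≠ 0) :
    reducedOutput α x1 x2 =
      (α • fun p : Θ × Block n × Block n => p.2.1) + ((fun p => x1 p.1) + α • residual α x2) := by
  funext p
  simp only [reducedOutput, residual, Pi.add_apply, Pi.smul_apply, smul_add, smul_inv_smul₀ hα]
  abel

variable [MeasurableSpace Θ] {κ : Measure Θ}

/-- Joint law of `(Θ, (S₂, Z₁))`, where `Θ` collects everything but the second user's state that
a genie reveals to receiver 1. -/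
def genieLaw (κ : Measure Θ) (n : ℕ) (Q N : ℝ) : Measure (Θ × Block n × Block n) :=
  κ.prod ((iidGaussian n Q).prod (iidGaussian n N))

/-- Logarithm of the density of the true law of `(Θ, (S₂, Z₁))` relative to the law under which
the reduced output and the residual are independent of each other and of `Θ`, with i.i.d. centred
Gaussian coordinates of variances `T` and `σ`. -/
def logRatio (α Q N T σ : ℝ) (x1 : Θ → Block n) (x2 : Block n → Block n)
    (p : Θ × Block n × Block n) : ℝ :=
  logDensity Q p.2.1 + logDensity N p.2.2 - logDensity T (reducedOutput α x1 x2 p) -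
    logDensity σ (residual α x2 p)

instance instIsProbabilityMeasureGenieLaw [IsProbabilityMeasure κ] :
    IsProbabilityMeasure (genieLaw κ n Q N) := by
  unfold genieLaw; infer_instance

@[fun_prop]
lemma measurable_reducedOutput (hx1 : Measurable x1) (hx2 : Measurable x2) :
    Measurable (reducedOutput α x1 x2) := by
  unfold reducedOutput; fun_prop

@[fun_prop]
lemma measurable_residual (hx2 : Measurable x2) :
    Measurable (residual (Θ := Θ) α x2) := by
  unfold residual; fun_prop

lemma measurable_logRatio (hx1 : Measurable x1) (hx2 : Measurable x2) :
    Measurable (logRatio α Q N T σ x1 x2) := by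
  unfold logRatio; fun_prop

lemma measurePreserving_reducedOutput [SFinite κ] (hα : α ≠ 0) (hQ : 0 < Q) (hN : 0 < N)
    (hT : 0 < T) (hσ : 0 < σ) (hx1 : Measurable x1) (hx2 : Measurable x2) :
    MeasurePreserving (fun p => (p.1, reducedOutput α x1 x2 p))
      ((genieLaw κ n Q N).withDensity fun p =>
        ENNReal.ofReal (Real.exp (-logRatio α Q N T σ x1 x2 p)))
      (κ.prod (iidGaussian n T)) := by
  have hshear := measurePreserving_shear_iidGaussian κ hQ hN hT hσ
    (m := fun θ s => x1 θ + α • (x2 s + s)) (g := fun θ y => α⁻¹ • (y - x1 θ))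
    (by unfold Function.uncurry; fun_prop) (by unfold Function.uncurry; fun_prop)
  simp only [logRatio, ← inv_smul_reducedOutput_sub (x1 := x1) hα]
  exact ((MeasurePreserving.id κ).prod measurePreserving_fst).comp hshear

section Energy

variable [IsProbabilityMeasure κ]

lemma measurePreserving_snd_fst_genieLaw :
    MeasurePreserving (fun p : Θ × Block n × Block n => p.2.1) (genieLaw κ n Q N)
      (iidGaussian n Q) :=
  measurePreserving_fst.comp measurePreserving_snd

lemma measurePreserving_snd_snd_genieLaw :
    MeasurePreserving (fun p : Θ × Block n × Block n => p.2.2) (genieLaw κ n Q N)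
      (iidGaussian n N) :=
  measurePreserving_snd.comp measurePreserving_snd

lemma memLp_state_genieLaw :
    MemLp (fun p : Θ × Block n × Block n => p.2.1) 2 (genieLaw κ n Q N) :=
  (memLp_id_iidGaussian Q).comp_measurePreserving measurePreserving_snd_fst_genieLaw

lemma memLp_noise_genieLaw :
    MemLp (fun p : Θ × Block n × Block n => p.2.2) 2 (genieLaw κ n Q N) :=
  (memLp_id_iidGaussian N).comp_measurePreserving measurePreserving_snd_snd_genieLaw

lemma meanEnergy_state_genieLaw (hQ : 0 ≤ Q) :
    meanEnergy (genieLaw κ n Q N) (fun p => p.2.1) = n * Q :=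
  (meanEnergy_comp measurePreserving_snd_fst_genieLaw measurable_id').trans
    (meanEnergy_id_iidGaussian hQ)

lemma meanEnergy_noise_genieLaw (hN : 0 ≤ N) :
    meanEnergy (genieLaw κ n Q N) (fun p => p.2.2) = n * N :=
  (meanEnergy_comp measurePreserving_snd_snd_genieLaw measurable_id').trans
    (meanEnergy_id_iidGaussian hN)

lemma memLp_residual (hx2 : MemLp x2 2 (iidGaussian n Q)) :
    MemLp (residual α x2) 2 (genieLaw κ n Q N) :=
  (hx2.comp_measurePreserving measurePreserving_snd_fst_genieLaw).add
    (memLp_noise_genieLaw.const_smul α⁻¹)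

lemma memLp_input_add_smul_residual (hx1 : MemLp x1 2 κ) (hx2 : MemLp x2 2 (iidGaussian n Q)) :
    MemLp ((fun p => x1 p.1) + α • residual α x2) 2 (genieLaw κ n Q N) :=
  (hx1.comp_fst _).add ((memLp_residual hx2).const_smul α)

lemma memLp_reducedOutput (hα : α ≠ 0) (hx1 : MemLp x1 2 κ)
    (hx2 : MemLp x2 2 (iidGaussian n Q)) :
    MemLp (reducedOutput α x1 x2) 2 (genieLaw κ n Q N) := by
  rw [reducedOutput_eq_smul_add hα]
  exact (memLp_state_genieLaw.const_smul α).add (memLp_input_add_smul_residual hx1 hx2)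

lemma meanEnergy_residual (hN : 0 ≤ N) (hx2m : Measurable x2)
    (hx2 : MemLp x2 2 (iidGaussian n Q)) :
    meanEnergy (genieLaw κ n Q N) (residual α x2) =
      meanEnergy (iidGaussian n Q) x2 + α⁻¹ ^ 2 * (n * N) := by
  rw [← meanEnergy_add_smul_iidGaussian hx2 α⁻¹ hN,
    ← meanEnergy_comp (f := fun p : Block n × Block n => x2 p.1 + α⁻¹ • p.2)
      (measurePreserving_snd (μ := κ)) (by fun_prop)]
  rfl

/-- Only the dominant term `α S₂` has to be kept with a constant close to one, since the others
stay bounded as `Q` grows. -/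
lemma meanEnergy_reducedOutput_le (hα : α ≠ 0) (hQ : 0 ≤ Q) (hx1m : Measurable x1)
    (hx1 : MemLp x1 2 κ) (hx2 : MemLp x2 2 (iidGaussian n Q)) {δ : ℝ} (hδ : 0 < δ) :
    meanEnergy (genieLaw κ n Q N) (reducedOutput α x1 x2) ≤
      (1 + δ) * (α ^ 2 * (n * Q)) + 2 * (1 + 1 / δ) *
        (meanEnergy κ x1 + α ^ 2 * meanEnergy (genieLaw κ n Q N) (residual α x2)) := by
  have hinput : meanEnergy (genieLaw κ n Q N) (fun p => x1 p.1) = meanEnergy κ x1 :=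
    meanEnergy_comp measurePreserving_fst hx1m
  have hrest : meanEnergy (genieLaw κ n Q N) ((fun p => x1 p.1) + α • residual α x2) ≤
      (1 + 1) * meanEnergy (genieLaw κ n Q N) (fun p => x1 p.1) +
        (1 + 1 / 1) * meanEnergy (genieLaw κ n Q N) (α • residual α x2) :=
    meanEnergy_add_le (hx1.comp_fst _) ((memLp_residual hx2).const_smul α) one_pos
  have hsplit : meanEnergy (genieLaw κ n Q N) (reducedOutput α x1 x2) ≤
      (1 + δ) * meanEnergy (genieLaw κ n Q N) (α • fun p => p.2.1) +
        (1 + 1 / δ) * meanEnergy (genieLaw κ n Q N) ((fun p => x1 p.1) + α • residual α x2) := by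
    rw [reducedOutput_eq_smul_add hα]
    exact meanEnergy_add_le (memLp_state_genieLaw.const_smul α)
      (memLp_input_add_smul_residual hx1 hx2) hδ
  rw [meanEnergy_smul, meanEnergy_state_genieLaw hQ] at hsplit
  rw [meanEnergy_smul, hinput] at hrest
  have hrest' := mul_le_mul_of_nonneg_left hrest (by positivity : 0 ≤ 1 + 1 / δ)
  linarith

lemma integrable_logRatio (hα : α ≠ 0) (hx1 : MemLp x1 2 κ)
    (hx2 : MemLp x2 2 (iidGaussian n Q)) :
    Integrable (logRatio α Q N T σ x1 x2) (genieLaw κ n Q N) :=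
  (((integrable_logDensity Q memLp_state_genieLaw).add
    (integrable_logDensity N memLp_noise_genieLaw)).sub
    (integrable_logDensity T (memLp_reducedOutput hα hx1 hx2))).sub
    (integrable_logDensity σ (memLp_residual hx2))

lemma integral_logRatio (hα : α ≠ 0) (hQ : 0 < Q) (hN : 0 < N) (hT : 0 < T) (hσ : 0 < σ)
    (hx1 : MemLp x1 2 κ) (hx2 : MemLp x2 2 (iidGaussian n Q)) :
    ∫ p, logRatio α Q N T σ x1 x2 p ∂genieLaw κ n Q N =
      n / 2 * Real.log (T * σ / (Q * N)) - n +
        meanEnergy (genieLaw κ n Q N) (reducedOutput α x1 x2) / (2 * T) +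
        meanEnergy (genieLaw κ n Q N) (residual α x2) / (2 * σ) := by
  have hS := memLp_state_genieLaw (κ := κ) (n := n) (Q := Q) (N := N)
  have hZ := memLp_noise_genieLaw (κ := κ) (n := n) (Q := Q) (N := N)
  have hY := memLp_reducedOutput (N := N) hα hx1 hx2
  have hE := memLp_residual (κ := κ) (α := α) (N := N) hx2
  have hiS := integrable_logDensity Q hS
  have hiZ := integrable_logDensity N hZ
  have hiY := integrable_logDensity T hY
  have hiE := integrable_logDensity σ hE
  have hiSZ := hiS.fun_add hiZ
  have hiSZY : Integrable (fun p => logDensity Q p.2.1 + logDensity N p.2.2 -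
      logDensity T (reducedOutput α x1 x2 p)) (genieLaw κ n Q N) := hiSZ.sub hiY
  have hπ : (2 * Real.pi) ≠ 0 := by positivity
  simp only [logRatio]
  rw [integral_sub hiSZY hiE, integral_sub hiSZ hiY,
    integral_add hiS hiZ, integral_logDensity Q hS, integral_logDensity N hZ,
    integral_logDensity T hY, integral_logDensity σ hE,
    meanEnergy_state_genieLaw hQ.le, meanEnergy_noise_genieLaw hN.le,
    Real.log_div (by positivity) (by positivity), Real.log_mul hT.ne' hσ.ne',
    Real.log_mul hQ.ne' hN.ne', Real.log_mul hπ hQ.ne', Real.log_mul hπ hN.ne',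
    Real.log_mul hπ hT.ne', Real.log_mul hπ hσ.ne']
  field_simp
  ring

end Energy

section Codebook

variable {ι : Type*} [Fintype ι] [IsProbabilityMeasure κ]
  {x1 : ι → Θ → Block n} {x2 : ι → Block n → Block n}

/-- The variances `T` and `σ` dominate the average powers of the reduced output and of the
residual, so the quadratic terms cost at most the `n` that the normalisations give back. -/
lemma sum_integral_logRatio_le (hα : α ≠ 0) (hQ : 0 < Q) (hN : 0 < N) (hT : 0 < T) (hσ : 0 < σ)
    (hx1m : ∀ w, Measurable (x1 w)) (hx2m : ∀ w, Measurable (x2 w))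
    (hx1 : ∀ w, MemLp (x1 w) 2 κ) (hx2 : ∀ w, MemLp (x2 w) 2 (iidGaussian n Q))
    {P1 P2 δ : ℝ} (hP1 : ∑ w, meanEnergy κ (x1 w) ≤ Fintype.card ι * (n * P1))
    (hP2 : ∑ w, meanEnergy (iidGaussian n Q) (x2 w) ≤ Fintype.card ι * (n * P2))
    (hδ : 0 < δ) (hσ' : P2 + α⁻¹ ^ 2 * N ≤ σ)
    (hT' : (1 + δ) * (α ^ 2 * Q) + 2 * (1 + 1 / δ) * (P1 + α ^ 2 * σ) ≤ T) :
    ∑ w, ∫ p, logRatio α Q N T σ (x1 w) (x2 w) p ∂genieLaw κ n Q N ≤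
      Fintype.card ι * (n / 2 * Real.log (T * σ / (Q * N))) := by
  have hresidual : ∑ w, meanEnergy (genieLaw κ n Q N) (residual α (x2 w)) ≤
      Fintype.card ι * (n * σ) := by
    simp only [fun w => meanEnergy_residual (κ := κ) (α := α) hN.le (hx2m w) (hx2 w)]
    rw [Finset.sum_add_distrib, Finset.sum_const, Finset.card_univ, nsmul_eq_mul]
    calc _ ≤ Fintype.card ι * (n * P2) + Fintype.card ι * (α⁻¹ ^ 2 * (n * N)) := by gcongr
      _ = Fintype.card ι * (n * (P2 + α⁻¹ ^ 2 * N)) := by ring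
      _ ≤ _ := by gcongr
  have houtput : ∑ w, meanEnergy (genieLaw κ n Q N) (reducedOutput α (x1 w) (x2 w)) ≤
      Fintype.card ι * (n * T) := by
    refine (Finset.sum_le_sum fun w _ => meanEnergy_reducedOutput_le (N := N) hα hQ.le (hx1m w)
      (hx1 w) (hx2 w) hδ).trans ?_
    rw [Finset.sum_add_distrib, Finset.sum_const, Finset.card_univ, nsmul_eq_mul,
      ← Finset.mul_sum, Finset.sum_add_distrib, ← Finset.mul_sum]
    calc _ ≤ Fintype.card ι * ((1 + δ) * (α ^ 2 * (n * Q))) + 2 * (1 + 1 / δ) *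
          (Fintype.card ι * (n * P1) + α ^ 2 * (Fintype.card ι * (n * σ))) := by gcongr
      _ = Fintype.card ι * (n * ((1 + δ) * (α ^ 2 * Q) + 2 * (1 + 1 / δ) * (P1 + α ^ 2 * σ))) := by
          ring
      _ ≤ _ := by gcongr
  simp only [fun w => integral_logRatio (κ := κ) hα hQ hN hT hσ (hx1 w) (hx2 w),
    Finset.sum_add_distrib, ← Finset.sum_div, Finset.sum_const, Finset.card_univ, nsmul_eq_mul]
  calc _ ≤ Fintype.card ι * (n / 2 * Real.log (T * σ / (Q * N)) - n) +
        Fintype.card ι * (n * T) / (2 * T) + Fintype.card ι * (n * σ) / (2 * σ) := by gcongr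
    _ = _ := by
        field_simp
        ring

lemma log_card_mul_sum_measureReal_genieLaw_le (hα : α ≠ 0) (hQ : 0 < Q) (hN : 0 < N)
    (hT : 0 < T) (hσ : 0 < σ)
    (hx1m : ∀ w, Measurable (x1 w)) (hx2m : ∀ w, Measurable (x2 w))
    (hx1 : ∀ w, MemLp (x1 w) 2 κ) (hx2 : ∀ w, MemLp (x2 w) 2 (iidGaussian n Q))
    {P1 P2 δ : ℝ} (hP1 : ∑ w, meanEnergy κ (x1 w) ≤ Fintype.card ι * (n * P1))
    (hP2 : ∑ w, meanEnergy (iidGaussian n Q) (x2 w) ≤ Fintype.card ι * (n * P2))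
    (hδ : 0 < δ) (hσ' : P2 + α⁻¹ ^ 2 * N ≤ σ)
    (hT' : (1 + δ) * (α ^ 2 * Q) + 2 * (1 + 1 / δ) * (P1 + α ^ 2 * σ) ≤ T)
    {A : ι → Set (Θ × Block n)} (hA : ∀ w, MeasurableSet (A w))
    (hdisj : Pairwise (Function.onFun Disjoint A)) :
    Real.log (Fintype.card ι) * ∑ w, (genieLaw κ n Q N).real
        {p | (p.1, reducedOutput α (x1 w) (x2 w) p) ∈ A w} ≤
      Fintype.card ι * (n / 2 * Real.log (T * σ / (Q * N)) + 1) := by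
  have hpack := log_card_mul_sum_measureReal_le (P := fun _ => genieLaw κ n Q N)
    (fun w => measurable_logRatio (hx1m w) (hx2m w))
    (fun w => integrable_logRatio (T := T) (σ := σ) hα (hx1 w) (hx2 w))
    (fun w => measurePreserving_reducedOutput hα hQ hN hT hσ (hx1m w) (hx2m w)) hA hdisj
  have hcost := sum_integral_logRatio_le hα hQ hN hT hσ hx1m hx2m hx1 hx2 hP1 hP2 hδ hσ' hT'
  rw [mul_add, mul_one]
  exact hpack.trans (add_le_add_left hcost _)

end Codebook

end GenieAided

section Converse

variable {n M M1 M2 : ℕ}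

lemma PowerLimited.memLp {enc : Fin M → Block n → Block n} {Q P : ℝ}
    (h : PowerLimited enc Q P) (henc : ∀ w, Measurable (enc w)) (w : Fin M) :
    MemLp (enc w) 2 (iidGaussian n Q) := by
  have hw := henc w
  exact memLp_pi_iff.2 fun j => (memLp_two_iff_integrable_sq (by fun_prop)).2 (h.1 w j)

lemma PowerLimited.sum_meanEnergy_le {enc : Fin M → Block n → Block n} {Q P : ℝ}
    (h : PowerLimited enc Q P) :
    ∑ w, meanEnergy (iidGaussian n Q) (enc w) ≤ M * (n * P) := by
  have henergy (w : Fin M) : meanEnergy (iidGaussian n Q) (enc w) =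
      ∑ j, ∫ s, enc w s j ^ 2 ∂iidGaussian n Q := by
    simp only [meanEnergy, dotProduct, ← sq]
    exact integral_finsetSum _ fun j _ => h.1 w j
  simp only [henergy]
  rcases n.eq_zero_or_pos with rfl | hn
  · simp
  rcases M.eq_zero_or_pos with rfl | hM
  · simp
  have hle := h.2
  rw [← Finset.mul_sum, Finset.sum_comm, one_div, one_div,
    inv_mul_le_iff₀ (Nat.cast_pos.2 hn), inv_mul_le_iff₀ (Nat.cast_pos.2 hM)] at hle
  exact hle

instance instIsProbabilityMeasureLaw (c : ASDGIC) (n : ℕ) : IsProbabilityMeasure (c.law n) := by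
  unfold law; infer_instance

lemma mul_errorProb (c : ASDGIC) (C : Code n M1 M2) :
    (M1 : ℝ) * M2 * c.errorProb C =
      ∑ w : Fin M1 × Fin M2, (c.law n).real (c.errorEvent C w.1 w.2) := by
  rw [errorProb, Fintype.sum_prod_type]
  rcases M1.eq_zero_or_pos with rfl | h1
  · simp
  rcases M2.eq_zero_or_pos with rfl | h2
  · simp
  field_simp

section Receivers

variable (c : ASDGIC) (C : Code n M1 M2) (w : Fin M1 × Fin M2)

/-- Decoding error at receiver 1, as an event for `((S₁, S₂), Z₁)`. -/
def receiverError1 : Set ((Block n × Block n) × Block n) :=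
  {p | C.dec1 (c.output1 (C.enc1 w.1 p.1.1) (C.enc2 w.2 p.1.2) p.1.1 p.1.2 p.2) ≠ w.1}

/-- Decoding error at receiver 2, as an event for `((S₁, S₂), Z₂)`. -/
def receiverError2 : Set ((Block n × Block n) × Block n) :=
  {p | C.dec2 (c.output2 (C.enc1 w.1 p.1.1) (C.enc2 w.2 p.1.2) p.1.1 p.1.2 p.2) ≠ w.2}

lemma errorEvent_eq_union :
    c.errorEvent C w.1 w.2 = (fun ω => (ω.1, ω.2.1)) ⁻¹' c.receiverError1 C w ∪
      (fun ω => (ω.1, ω.2.2)) ⁻¹' c.receiverError2 C w := rfl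

lemma measurableSet_receiverError1 : MeasurableSet (c.receiverError1 C w) := by
  have h1 := C.measurable_enc1 w.1
  have h2 := C.measurable_enc2 w.2
  refine (measurableSet_preimage (C.measurable_dec1.comp ?_) (measurableSet_singleton w.1)).compl
  unfold output1; fun_prop

lemma measurableSet_receiverError2 : MeasurableSet (c.receiverError2 C w) := by
  have h1 := C.measurable_enc1 w.1
  have h2 := C.measurable_enc2 w.2
  refine (measurableSet_preimage (C.measurable_dec2.comp ?_) (measurableSet_singleton w.2)).compl
  unfold output2; fun_prop

lemma measurableSet_errorEvent : MeasurableSet (c.errorEvent C w.1 w.2) := by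
  rw [errorEvent_eq_union]
  exact (measurableSet_preimage (by fun_prop) (c.measurableSet_receiverError1 C w)).union
    (measurableSet_preimage (by fun_prop) (c.measurableSet_receiverError2 C w))

lemma measureReal_receiverError1_le :
    (((iidGaussian n c.Q1).prod (iidGaussian n c.Q2)).prod (iidGaussian n c.N1)).real
      (c.receiverError1 C w) ≤ (c.law n).real (c.errorEvent C w.1 w.2) := by
  have hmarginal : MeasurePreserving (fun ω => (ω.1, ω.2.1)) (c.law n) _ :=
    (MeasurePreserving.id _).prod measurePreserving_fst
  rw [← hmarginal.measureReal_preimage (c.measurableSet_receiverError1 C w).nullMeasurableSet]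
  exact measureReal_mono Set.subset_union_left

lemma measureReal_receiverError2_le :
    (((iidGaussian n c.Q1).prod (iidGaussian n c.Q2)).prod (iidGaussian n c.N2)).real
      (c.receiverError2 C w) ≤ (c.law n).real (c.errorEvent C w.1 w.2) := by
  have hmarginal : MeasurePreserving (fun ω => (ω.1, ω.2.2)) (c.law n) _ :=
    (MeasurePreserving.id _).prod measurePreserving_snd
  rw [← hmarginal.measureReal_preimage (c.measurableSet_receiverError2 C w).nullMeasurableSet]
  exact measureReal_mono Set.subset_union_right

end Receivers

variable {c : ASDGIC} {C : Code n M1 M2} {w : Fin M1 × Fin M2}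

/-- Law of the pair `(S₁, V)` that a genie reveals to receiver 1, where the auxiliary noise `V`
makes `Z₁ / √a₁₂ + V` distributed like `Z₂`. -/
def sideInfoLaw (c : ASDGIC) (n : ℕ) : Measure (Block n × Block n) :=
  (iidGaussian n c.Q1).prod (iidGaussian n (c.N2 - c.N1 / c.a12))

instance instIsProbabilityMeasureSideInfoLaw (c : ASDGIC) (n : ℕ) :
    IsProbabilityMeasure (c.sideInfoLaw n) := by
  unfold sideInfoLaw; infer_instance

lemma measurePreserving_noise1 :
    MeasurePreserving (fun p : (Block n × Block n) × Block n × Block n =>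
        ((p.1.1, p.2.1), p.2.2)) (genieLaw (c.sideInfoLaw n) n c.Q2 c.N1)
      (((iidGaussian n c.Q1).prod (iidGaussian n c.Q2)).prod (iidGaussian n c.N1)) :=
  ((MeasurePreserving.id _).prod measurePreserving_snd).comp
    (measurePreserving_prodProdProdComm _ _ _ _)

/-- The noise at receiver 2 may be replaced by a degraded version of the noise at receiver 1:
neither receiver sees the joint law of `Z₁` and `Z₂`. -/
lemma measurePreserving_noise2 (h12 : 0 < c.a12) (hN1 : 0 ≤ c.N1)
    (hdeg : c.N1 / c.a12 ≤ c.N2) :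
    MeasurePreserving (fun p : (Block n × Block n) × Block n × Block n =>
        ((p.1.1, p.2.1), (√c.a12)⁻¹ • p.2.2 + p.1.2)) (genieLaw (c.sideInfoLaw n) n c.Q2 c.N1)
      (((iidGaussian n c.Q1).prod (iidGaussian n c.Q2)).prod (iidGaussian n c.N2)) := by
  have hsum := measurePreserving_smul_add_iidGaussian n (√c.a12)⁻¹ hN1 (sub_nonneg.2 hdeg)
  rw [inv_pow, Real.sq_sqrt h12.le, inv_mul_eq_div, add_sub_cancel] at hsum
  exact ((MeasurePreserving.id _).prod (hsum.comp Measure.measurePreserving_swap)).comp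
    (measurePreserving_prodProdProdComm _ _ _ _)

/-- The values of `((S₁, V), Y)`, with `Y` the reduced output, from which receiver 1 decodes the
message pair `w`: it recovers `Y₁ = Y + S₁` and, knowing `W₁` after the first decoding, the
output `Y₂` with noise `Z₁ / √a₁₂ + V`. -/
def jointDecodingRegion (c : ASDGIC) (C : Code n M1 M2) (w : Fin M1 × Fin M2) :
    Set ((Block n × Block n) × Block n) :=
  {p | C.dec1 (p.2 + p.1.1) = w.1 ∧
    C.dec2 (√c.a21 • (C.enc1 w.1 p.1.1 + p.1.1) +
      (√c.a12)⁻¹ • (p.2 - C.enc1 w.1 p.1.1) + p.1.2) = w.2}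

lemma measurableSet_jointDecodingRegion (c : ASDGIC) (C : Code n M1 M2) (w : Fin M1 × Fin M2) :
    MeasurableSet (c.jointDecodingRegion C w) := by
  have h1 := C.measurable_enc1 w.1
  refine MeasurableSet.inter
    (measurableSet_preimage (C.measurable_dec1.comp ?_) (measurableSet_singleton w.1))
    (measurableSet_preimage (C.measurable_dec2.comp ?_) (measurableSet_singleton w.2)) <;>
  fun_prop

lemma pairwise_disjoint_jointDecodingRegion (c : ASDGIC) (C : Code n M1 M2) :
    Pairwise (Function.onFun Disjoint (c.jointDecodingRegion C)) := by
  rintro ⟨w1, w2⟩ ⟨w1', w2'⟩ hne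
  refine Set.disjoint_left.2 fun p hp hp' => hne ?_
  obtain rfl : w1 = w1' := hp.1.symm.trans hp'.1
  exact congrArg _ (hp.2.symm.trans hp'.2)

lemma mem_jointDecodingRegion (h12 : 0 < c.a12) {p : (Block n × Block n) × Block n × Block n}
    (h1 : ((p.1.1, p.2.1), p.2.2) ∉ c.receiverError1 C w)
    (h2 : ((p.1.1, p.2.1), (√c.a12)⁻¹ • p.2.2 + p.1.2) ∉ c.receiverError2 C w) :
    (p.1, reducedOutput (√c.a12) (fun θ => C.enc1 w.1 θ.1) (C.enc2 w.2) p) ∈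
      c.jointDecodingRegion C w := by
  have hα : √c.a12 ≠ 0 := (Real.sqrt_pos.2 h12).ne'
  refine ⟨(congrArg C.dec1 ?_).trans (not_not.1 h1), (congrArg C.dec2 ?_).trans (not_not.1 h2)⟩
  · simp only [reducedOutput, output1, smul_add]
    abel
  · simp only [reducedOutput, output2, smul_add, smul_sub, inv_smul_smul₀ hα]
    abel

lemma one_sub_two_mul_measureReal_errorEvent_le (h12 : 0 < c.a12) (hN1 : 0 ≤ c.N1)
    (hdeg : c.N1 / c.a12 ≤ c.N2) :
    1 - 2 * (c.law n).real (c.errorEvent C w.1 w.2) ≤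
      (genieLaw (c.sideInfoLaw n) n c.Q2 c.N1).real
        {p | (p.1, reducedOutput (√c.a12) (fun θ => C.enc1 w.1 θ.1) (C.enc2 w.2) p) ∈
          c.jointDecodingRegion C w} := by
  set μ := genieLaw (c.sideInfoLaw n) n c.Q2 c.N1
  set S := {p | (p.1, reducedOutput (√c.a12) (fun θ => C.enc1 w.1 θ.1) (C.enc2 w.2) p) ∈
    c.jointDecodingRegion C w}
  have hS : MeasurableSet S := by
    have h1 := C.measurable_enc1 w.1
    have h2 := C.measurable_enc2 w.2
    exact measurableSet_preimage (by fun_prop) (c.measurableSet_jointDecodingRegion C w)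
  have hsubset : Sᶜ ⊆ (fun p => ((p.1.1, p.2.1), p.2.2)) ⁻¹' c.receiverError1 C w ∪
      (fun p => ((p.1.1, p.2.1), (√c.a12)⁻¹ • p.2.2 + p.1.2)) ⁻¹' c.receiverError2 C w := by
    refine Set.compl_subset_comm.1 fun p hp => ?_
    rw [Set.compl_union] at hp
    exact mem_jointDecodingRegion h12 hp.1 hp.2
  have hunion : μ.real Sᶜ ≤ _ := (measureReal_mono hsubset).trans (measureReal_union_le _ _)
  rw [probReal_compl_eq_one_sub hS,
    measurePreserving_noise1.measureReal_preimage
      (c.measurableSet_receiverError1 C w).nullMeasurableSet,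
    (measurePreserving_noise2 h12 hN1 hdeg).measureReal_preimage
      (c.measurableSet_receiverError2 C w).nullMeasurableSet] at hunion
  linarith [c.measureReal_receiverError1_le C w, c.measureReal_receiverError2_le C w]

/-- The variance `σ` of the residual under the auxiliary law. -/
def residualVariance (c : ASDGIC) : ℝ := c.P2 + c.N1 / c.a12

/-- The variance `T` of the reduced output under the auxiliary law: up to the slack `δ` the power
`a₁₂ Q₂` of the interfering state, plus a term bounded in `Q₂`. -/
def outputVariance (c : ASDGIC) (δ : ℝ) : ℝ :=
  (1 + δ) * (c.a12 * c.Q2) + 2 * (1 + 1 / δ) * (c.P1 + c.a12 * c.residualVariance)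

lemma residualVariance_pos (h12 : 0 < c.a12) (hP2 : 0 < c.P2) (hN1 : 0 < c.N1) :
    0 < c.residualVariance := by
  unfold residualVariance; positivity

lemma outputVariance_pos (h12 : 0 < c.a12) (hP1 : 0 < c.P1) (hP2 : 0 < c.P2) (hN1 : 0 < c.N1)
    (hQ2 : 0 < c.Q2) {δ : ℝ} (hδ : 0 < δ) : 0 < c.outputVariance δ := by
  have hσ := residualVariance_pos h12 hP2 hN1
  unfold outputVariance; positivity

lemma log_mul_sum_measureReal_jointDecodingRegion_le (h12 : 0 < c.a12) (hP1 : 0 < c.P1)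
    (hP2 : 0 < c.P2) (hN1 : 0 < c.N1) (hQ2 : 0 < c.Q2) (hp1 : PowerLimited C.enc1 c.Q1 c.P1)
    (hp2 : PowerLimited C.enc2 c.Q2 c.P2) {δ : ℝ} (hδ : 0 < δ) :
    Real.log (M1 * M2) * ∑ w : Fin M1 × Fin M2, (genieLaw (c.sideInfoLaw n) n c.Q2 c.N1).real
        {p | (p.1, reducedOutput (√c.a12) (fun θ => C.enc1 w.1 θ.1) (C.enc2 w.2) p) ∈
          c.jointDecodingRegion C w} ≤
      M1 * M2 * (n / 2 *
        Real.log (c.outputVariance δ * c.residualVariance / (c.Q2 * c.N1)) + 1) := by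
  have hα : √c.a12 ≠ 0 := (Real.sqrt_pos.2 h12).ne'
  have hfst : MeasurePreserving Prod.fst (c.sideInfoLaw n) (iidGaussian n c.Q1) :=
    measurePreserving_fst
  have hpower1 : ∑ w : Fin M1 × Fin M2, meanEnergy (c.sideInfoLaw n)
      (fun θ => C.enc1 w.1 θ.1) ≤ Fintype.card (Fin M1 × Fin M2) * (n * c.P1) := by
    have henergy (w1 : Fin M1) := meanEnergy_comp hfst (C.measurable_enc1 w1)
    simp only [Fintype.sum_prod_type, henergy, Finset.sum_const, Finset.card_univ,
      Fintype.card_prod, Fintype.card_fin, nsmul_eq_mul, ← Finset.mul_sum]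
    grw [hp1.sum_meanEnergy_le]
    push_cast
    exact le_of_eq (by ring)
  have hpower2 : ∑ w : Fin M1 × Fin M2, meanEnergy (iidGaussian n c.Q2) (C.enc2 w.2) ≤
      Fintype.card (Fin M1 × Fin M2) * (n * c.P2) := by
    simp only [Fintype.sum_prod_type_right, Finset.sum_const, Finset.card_univ,
      Fintype.card_prod, Fintype.card_fin, nsmul_eq_mul, ← Finset.mul_sum]
    grw [hp2.sum_meanEnergy_le]
    push_cast
    exact le_of_eq (by ring)
  have hmain := log_card_mul_sum_measureReal_genieLaw_le (κ := c.sideInfoLaw n)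
    (x1 := fun w : Fin M1 × Fin M2 => fun θ => C.enc1 w.1 θ.1) hα hQ2 hN1
    (outputVariance_pos h12 hP1 hP2 hN1 hQ2 hδ) (residualVariance_pos h12 hP2 hN1)
    (fun w => (C.measurable_enc1 w.1).comp measurable_fst) (fun w => C.measurable_enc2 w.2)
    (fun w => (hp1.memLp C.measurable_enc1 w.1).comp_measurePreserving hfst)
    (fun w => hp2.memLp C.measurable_enc2 w.2) hpower1 hpower2 hδ
    (by rw [inv_pow, Real.sq_sqrt h12.le, inv_mul_eq_div, residualVariance])
    (by rw [Real.sq_sqrt h12.le, outputVariance])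
    (c.measurableSet_jointDecodingRegion C) (c.pairwise_disjoint_jointDecodingRegion C)
  simpa only [Fintype.card_prod, Fintype.card_fin, Nat.cast_mul] using hmain

lemma one_sub_errorProb_mul_log_le (hM1 : 0 < M1) (hM2 : 0 < M2) (h12 : 0 < c.a12)
    (hP1 : 0 < c.P1) (hP2 : 0 < c.P2) (hN1 : 0 < c.N1) (hQ2 : 0 < c.Q2)
    (hdeg : c.N1 / c.a12 ≤ c.N2) (hp1 : PowerLimited C.enc1 c.Q1 c.P1)
    (hp2 : PowerLimited C.enc2 c.Q2 c.P2) {δ : ℝ} (hδ : 0 < δ) :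
    (1 - 2 * c.errorProb C) * Real.log (M1 * M2) ≤
      n / 2 * Real.log (c.outputVariance δ * c.residualVariance / (c.Q2 * c.N1)) + 1 := by
  have hcard : (1 : ℝ) ≤ M1 * M2 := by exact_mod_cast Nat.mul_pos hM1 hM2
  have hprob := Finset.sum_le_sum fun w (_ : w ∈ Finset.univ) =>
    one_sub_two_mul_measureReal_errorEvent_le (C := C) (w := w) h12 hN1.le hdeg
  rw [Finset.sum_sub_distrib, ← Finset.mul_sum, ← c.mul_errorProb C] at hprob
  simp only [Finset.sum_const, Finset.card_univ, Fintype.card_prod, Fintype.card_fin,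
    nsmul_eq_mul, mul_one, Nat.cast_mul] at hprob
  refine le_of_mul_le_mul_left ?_ (zero_lt_one.trans_le hcard)
  calc _ = Real.log (M1 * M2) * (M1 * M2 - 2 * (M1 * M2 * c.errorProb C)) := by ring
    _ ≤ _ := mul_le_mul_of_nonneg_left hprob (Real.log_nonneg hcard)
    _ ≤ _ := log_mul_sum_measureReal_jointDecodingRegion_le h12 hP1 hP2 hN1 hQ2 hp1 hp2 hδ

lemma numMessages_pos (n : ℕ) (R : ℝ) : 0 < numMessages n R :=
  Nat.ceil_pos.2 (by positivity)

lemma mul_log_two_le_log_numMessages (n : ℕ) (R : ℝ) :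
    n * R * Real.log 2 ≤ Real.log (numMessages n R) := by
  rw [← Real.log_rpow two_pos]
  exact Real.log_le_log (by positivity) (Nat.le_ceil _)

lemma mul_add_mul_log_two_le_log_mul_numMessages (n : ℕ) (R : ℝ × ℝ) :
    n * ((R.1 + R.2) * Real.log 2) ≤ Real.log (numMessages n R.1 * numMessages n R.2) := by
  have h1 : (numMessages n R.1 : ℝ) ≠ 0 := Nat.cast_ne_zero.2 (numMessages_pos n R.1).ne'
  have h2 : (numMessages n R.2 : ℝ) ≠ 0 := Nat.cast_ne_zero.2 (numMessages_pos n R.2).ne'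
  rw [Real.log_mul h1 h2]
  linarith [mul_log_two_le_log_numMessages n R.1, mul_log_two_le_log_numMessages n R.2]

lemma Achievable.add_mul_log_two_le {R : ℝ × ℝ} (hR : c.Achievable R)
    (h12 : 0 < c.a12) (hP1 : 0 < c.P1) (hP2 : 0 < c.P2) (hN1 : 0 < c.N1) (hQ2 : 0 < c.Q2)
    (hdeg : c.N1 / c.a12 ≤ c.N2) {δ : ℝ} (hδ : 0 < δ) :
    (R.1 + R.2) * Real.log 2 ≤
      1 / 2 * Real.log (c.outputVariance δ * c.residualVariance / (c.Q2 * c.N1)) := by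
  obtain ⟨-, -, C, hpower, herror⟩ := hR
  set L := Real.log (c.outputVariance δ * c.residualVariance / (c.Q2 * c.N1))
  have hleft : Tendsto (fun n => (1 - 2 * c.errorProb (C n)) * ((R.1 + R.2) * Real.log 2)) atTop
      (𝓝 ((1 - 2 * 0) * ((R.1 + R.2) * Real.log 2))) :=
    ((herror.const_mul 2).const_sub 1).mul_const _
  have hright : Tendsto (fun n : ℕ => 1 / 2 * L + 1 / (n : ℝ)) atTop (𝓝 (1 / 2 * L + 0)) :=
    tendsto_one_div_atTop_nhds_zero_nat.const_add _
  have hsmall : ∀ᶠ n in atTop, c.errorProb (C n) < 1 / 2 :=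
    herror.eventually (gt_mem_nhds (by norm_num))
  have hfinite : ∀ᶠ n : ℕ in atTop,
      (1 - 2 * c.errorProb (C n)) * ((R.1 + R.2) * Real.log 2) ≤ 1 / 2 * L + 1 / (n : ℝ) := by
    filter_upwards [hsmall, eventually_gt_atTop 0] with n hn hpos
    have hn' : (0 : ℝ) < n := Nat.cast_pos.2 hpos
    refine le_of_mul_le_mul_left ?_ hn'
    calc _ = (1 - 2 * c.errorProb (C n)) * (n * ((R.1 + R.2) * Real.log 2)) := by ring
      _ ≤ (1 - 2 * c.errorProb (C n)) *
          Real.log (numMessages n R.1 * numMessages n R.2) :=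
          mul_le_mul_of_nonneg_left (mul_add_mul_log_two_le_log_mul_numMessages n R)
            (by linarith)
      _ ≤ n / 2 * L + 1 := one_sub_errorProb_mul_log_le (numMessages_pos n R.1)
          (numMessages_pos n R.2) h12 hP1 hP2 hN1 hQ2 hdeg (hpower n).1 (hpower n).2 hδ
      _ = _ := by field_simp
  simpa using le_of_tendsto_of_tendsto hleft hright hfinite

lemma log_outputVariance_mul_residualVariance_div_le (h12 : 0 < c.a12) (hP1 : 0 < c.P1)
    (hP2 : 0 < c.P2) (hN1 : 0 < c.N1) (hQ2 : 0 < c.Q2) {δ : ℝ} (hδ : 0 < δ) :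
    Real.log (c.outputVariance δ * c.residualVariance / (c.Q2 * c.N1)) ≤
      Real.log (1 + c.a12 * c.P2 / c.N1) + δ +
        2 * (1 + 1 / δ) * (c.P1 + c.a12 * c.residualVariance) / (c.a12 * c.Q2) := by
  have hσ := residualVariance_pos h12 hP2 hN1
  set K := 2 * (1 + 1 / δ) * (c.P1 + c.a12 * c.residualVariance) with hK
  have hKpos : 0 < K := by positivity
  have hfactor : c.outputVariance δ * c.residualVariance / (c.Q2 * c.N1) =
      (1 + c.a12 * c.P2 / c.N1) * (1 + δ + K / (c.a12 * c.Q2)) := by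
    rw [outputVariance, ← hK, residualVariance]
    field_simp
    ring
  rw [hfactor, Real.log_mul (by positivity) (by positivity)]
  linarith [Real.log_le_sub_one_of_pos (by positivity : 0 < 1 + δ + K / (c.a12 * c.Q2))]

lemma exists_forall_achievable_add_le {a12 a21 P1 P2 N1 N2 : ℝ} (hP1 : 0 < P1) (hP2 : 0 < P2)
    (hN1 : 0 < N1) (hN2 : 0 < N2) (ha12 : N1 / N2 ≤ a12) {ε : ℝ} (hε : 0 < ε) :
    ∃ Q0 : ℝ, ∀ Q1 Q2 : ℝ, Q0 ≤ Q2 → ∀ R,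
      Achievable ⟨a12, a21, P1, P2, N1, N2, Q1, Q2⟩ R →
        R.1 + R.2 ≤ 1 / 2 * Real.logb 2 (1 + a12 * P2 / N1) + ε := by
  have h12 : 0 < a12 := (div_pos hN1 hN2).trans_le ha12
  have hdeg : N1 / a12 ≤ N2 := (div_le_comm₀ hN2 h12).1 ha12
  have hlog2 : 0 < Real.log 2 := Real.log_pos one_lt_two
  set δ := ε * Real.log 2 with hδdef
  have hδ : 0 < δ := mul_pos hε hlog2
  set K := 2 * (1 + 1 / δ) * (P1 + a12 * (P2 + N1 / a12)) with hK
  have hQ0 : 0 < K / (a12 * δ) := by positivity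
  refine ⟨K / (a12 * δ), fun Q1 Q2 hQ R hR => ?_⟩
  have hQ2 : 0 < Q2 := hQ0.trans_le hQ
  have hsmall : K / (a12 * Q2) ≤ δ := by
    rw [div_le_iff₀ (by positivity)] at hQ ⊢
    linarith
  have hrate := hR.add_mul_log_two_le h12 hP1 hP2 hN1 hQ2 hdeg hδ
  have hlog := log_outputVariance_mul_residualVariance_div_le
    (c := ⟨a12, a21, P1, P2, N1, N2, Q1, Q2⟩) h12 hP1 hP2 hN1 hQ2 hδ
  simp only [residualVariance, ← hK] at hlog
  refine le_of_mul_le_mul_right ?_ hlog2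
  rw [Real.logb, add_mul (_ * _), mul_assoc, div_mul_cancel₀ _ hlog2.ne', ← hδdef]
  simp only [residualVariance] at hrate
  linarith

end Converse

section Swap

variable {n M1 M2 : ℕ} {c : ASDGIC}

/-- The channel with the two users exchanged, used to carry the bound at receiver 1 over to
receiver 2. -/
def swap (c : ASDGIC) : ASDGIC := ⟨c.a21, c.a12, c.P2, c.P1, c.N2, c.N1, c.Q2, c.Q1⟩

/-- The code with the two users exchanged, as a code for the exchanged channel. -/
def Code.swap (C : Code n M1 M2) : Code n M2 M1 where
  enc1 := C.enc2
  enc2 := C.enc1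
  dec1 := C.dec2
  dec2 := C.dec1
  measurable_enc1 := C.measurable_enc2
  measurable_enc2 := C.measurable_enc1
  measurable_dec1 := C.measurable_dec2
  measurable_dec2 := C.measurable_dec1

lemma output1_swap (c : ASDGIC) (x1 x2 s1 s2 z : Block n) :
    c.swap.output1 x2 x1 s2 s1 z = c.output2 x1 x2 s1 s2 z := by
  simp only [output1, output2, swap]
  abel

lemma output2_swap (c : ASDGIC) (x1 x2 s1 s2 z : Block n) :
    c.swap.output2 x2 x1 s2 s1 z = c.output1 x1 x2 s1 s2 z := by
  simp only [output1, output2, swap]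
  abel

lemma preimage_errorEvent_swap (c : ASDGIC) (C : Code n M1 M2) (w1 : Fin M1) (w2 : Fin M2) :
    Prod.map Prod.swap Prod.swap ⁻¹' c.swap.errorEvent C.swap w2 w1 = c.errorEvent C w1 w2 := by
  ext ω
  simp only [Set.mem_preimage, errorEvent, Set.mem_ofPred_eq, Prod.map_fst, Prod.map_snd,
    Prod.fst_swap, Prod.snd_swap, output1_swap, output2_swap, Code.swap]
  exact or_comm

lemma errorProb_swap (c : ASDGIC) (C : Code n M1 M2) :
    c.swap.errorProb C.swap = c.errorProb C := by
  have hswap : MeasurePreserving (Prod.map Prod.swap Prod.swap) (c.law n) (c.swap.law n) :=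
    Measure.measurePreserving_swap.prod Measure.measurePreserving_swap
  have hevent (w1 : Fin M1) (w2 : Fin M2) :
      (c.swap.law n).real (c.swap.errorEvent C.swap w2 w1) =
        (c.law n).real (c.errorEvent C w1 w2) := by
    rw [← preimage_errorEvent_swap c C, hswap.measureReal_preimage
      (c.swap.measurableSet_errorEvent C.swap (w2, w1)).nullMeasurableSet]
  simp only [errorProb, hevent]
  rw [Finset.sum_comm, mul_comm (M1 : ℝ)]

lemma Achievable.swap {R : ℝ × ℝ} (h : c.Achievable R) : c.swap.Achievable R.swap := by
  obtain ⟨h1, h2, C, hpower, herror⟩ := h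
  refine ⟨h2, h1, fun n => (C n).swap, fun n => (hpower n).symm, ?_⟩
  exact herror.congr fun n => (c.errorProb_swap (C n)).symm

end Swap

lemma isClosed_sumRateRegion (B : ℝ) : IsClosed (sumRateRegion B) :=
  (isClosed_le continuous_const continuous_fst).inter
    ((isClosed_le continuous_const continuous_snd).inter
      (isClosed_le (continuous_fst.add continuous_snd) continuous_const))

lemma exists_forall_capacityRegion_subset {a12 a21 P1 P2 N1 N2 : ℝ} (hP1 : 0 < P1) (hP2 : 0 < P2)
    (hN1 : 0 < N1) (hN2 : 0 < N2) (ha12 : N1 / N2 ≤ a12) (ha21 : N2 / N1 ≤ a21) {ε : ℝ}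
    (hε : 0 < ε) :
    ∃ Q0 : ℝ, ∀ Q1 Q2 : ℝ, Q0 ≤ Q1 → Q0 ≤ Q2 →
      capacityRegion ⟨a12, a21, P1, P2, N1, N2, Q1, Q2⟩ ⊆
        sumRateRegion (sumRateBound a12 a21 P1 P2 N1 N2 + ε) := by
  obtain ⟨q, hq⟩ := exists_forall_achievable_add_le (a21 := a21) hP1 hP2 hN1 hN2 ha12 hε
  obtain ⟨q', hq'⟩ := exists_forall_achievable_add_le (a21 := a12) hP2 hP1 hN2 hN1 ha21 hε
  refine ⟨max q q', fun Q1 Q2 hQ1 hQ2 =>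
    closure_minimal (fun R hR => ⟨hR.1, hR.2.1, ?_⟩) (isClosed_sumRateRegion _)⟩
  rw [sumRateBound, ← min_add_add_right]
  refine le_min (hq Q1 Q2 ((le_max_left _ _).trans hQ2) R hR) ?_
  have hswap := hq' Q2 Q1 ((le_max_right _ _).trans hQ1) R.swap hR.swap
  rwa [Prod.fst_swap, Prod.snd_swap, add_comm] at hswap

end ASDGIC

end

theorem theorem1 (a12 a21 P1 P2 N1 N2 : ℝ)
    (hP1 : 0 < P1) (hP2 : 0 < P2) (hN1 : 0 < N1) (hN2 : 0 < N2)
    (ha12 : N1 / N2 ≤ a12) (ha21 : N2 / N1 ≤ a21) :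
    ASDGIC.limitCapacityRegion a12 a21 P1 P2 N1 N2 ⊆
        ASDGIC.sumRateRegion (ASDGIC.sumRateBound a12 a21 P1 P2 N1 N2) ∧
      ∀ ε : ℝ, 0 < ε → ∃ Q0 : ℝ, ∀ Q1 Q2 : ℝ, Q0 ≤ Q1 → Q0 ≤ Q2 →
        ASDGIC.capacityRegion ⟨a12, a21, P1, P2, N1, N2, Q1, Q2⟩ ⊆
          ASDGIC.sumRateRegion (ASDGIC.sumRateBound a12 a21 P1 P2 N1 N2 + ε) := by
  have huniform (ε : ℝ) (hε : 0 < ε) := ASDGIC.exists_forall_capacityRegion_subset hP1 hP2 hN1 hN2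
    ha12 ha21 hε
  refine ⟨fun R hR => ?_, huniform⟩
  have hmem (ε : ℝ) (hε : 0 < ε) :
      R ∈ ASDGIC.sumRateRegion (ASDGIC.sumRateBound a12 a21 P1 P2 N1 N2 + ε) := by
    obtain ⟨Q0, hQ0⟩ := huniform ε hε
    rw [← (ASDGIC.isClosed_sumRateRegion _).closure_eq, mem_closure_iff_nhds]
    intro U hU
    obtain ⟨Q, ⟨R', hR', hR'U⟩, hQ1, hQ2⟩ := ((hR U hU).and_eventually
      ((eventually_ge_atTop Q0).prod_mk (eventually_ge_atTop Q0))).exists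
    exact ⟨R', hR'U, hQ0 Q.1 Q.2 hQ1 hQ2 hR'⟩
  exact ⟨(hmem 1 one_pos).1, (hmem 1 one_pos).2.1,
    le_of_forall_pos_le_add fun ε hε => (hmem ε hε).2.2⟩
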